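/- Let $(X,d)$ and $(Y_n,\delta_n)$, $n\in\mathbb N$, be nonempty separable complete metric spaces, let $p,q\in[1,\infty)$ and $C>0$. For metric spaces $(X_n,d_n)$, $E((X_n)_{n\in\mathbb N};p)$ denotes the equivalence relation on $\prod_n X_n$ under which $x,y$ are equivalent iff $\sum_n d_n(x(n),y(n))^p<\infty$. Fix any sequence $F_0\subseteq F_1\subseteq\cdots$ of nonempty finite subsets of $X$ with $\bigcup_n F_n$ dense in $X$ and let $F(X;p)=E((F_n)_{n\in\mathbb N};p)$, each $F_n$ carrying the metric of $X$. For equivalence relations $E,E'$ on topological spaces $P,P'$, write $E\le_B E'$ if there is a Borel map $\theta:P\to P'$ such that $x\mathrel{E}y\iff\theta(x)\mathrel{E'}\theta(y)$ for all $x,y\in P$; products carry the product topology. For $y^*\in\prod_n Y_n$, $\ell_q((Y_n)_{n\in\mathbb N},y^*)$ is the set of $y\in\prod_n Y_n$ with $\sum_n\delta_n(y(n),y^*(n))^q<\infty$, with the metric $\delta_q(x,y)=\left(\sum_n\delta_n(x(n),y(n))^q\right)^{1/q}$. Suppose that (i) $X$ satisfies link($C$): for every $\varepsilon>0$ there is $N\ge1$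 such that for all $u,v\in X$ with $d(u,v)<C$ there are $r_0,\dots,r_N\in X$ with $r_0=u$, $r_N=v$ and $d(r_{i-1},r_i)<\varepsilon$ for $i=1,\dots,N$; and (ii) $F(X;p)\le_B E((Y_n)_{n\in\mathbb N};q)$. Then, for every $y^*\in\prod_n Y_n$, $X$ can $C$-finitely Hölder$(p/q)$ embed into $\ell_q((Y_n)_{n\in\mathbb N},y^*)$. That is, there are $A,D>0$ such that for every finite $F\subseteq X$ there is a map $T_F:F\to\ell_q((Y_n)_{n\in\mathbb N},y^*)$ such that for all $u,v\in F$: (1) if $d(u,v)\ge C$, then $\delta_q(T_F(u),T_F(v))\ge D$; (2) if $d(u,v)<C$, then $A^{-1}d(u,v)^{p/q}\le\delta_q(T_F(u),T_F(v))\le A\,d(u,v)^{p/q}$. -/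

import Mathlib

/-- `E` (a relation on `α`) is Borel reducible to `F` (a relation on `β`): there is a map
`θ : α → β`, measurable for the Borel σ-algebras, with `E x y ↔ F (θ x) (θ y)`. -/
def BorelReducible {α β : Type*} [TopologicalSpace α] [TopologicalSpace β]
    (E : α → α → Prop) (F : β → β → Prop) : Prop :=
  ∃ θ : α → β, @Measurable α β (borel α) (borel β) θ ∧ ∀ x y, E x y ↔ F (θ x) (θ y)

/-- The `ℓ_p`-like equivalence relation `E((X_n); p)` on `∏ X_n`:
`∑ d_n(x(n), y(n))^p < ∞`. -/
def EllRel (X : ℕ → Type*) [∀ n, PseudoMetricSpace (X n)] (p : ℝ) (x y : ∀ n, X n) : Prop :=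
  Summable fun n => dist (x n) (y n) ^ p

/-- An increasing sequence of nonempty finite subsets of `X` with dense union.
For such a sequence `F(X; p)` is the relation `E((F_n); p)` on `∏ F_n`. -/
structure IsFiniteExhaustion {X : Type*} [MetricSpace X] (F : ℕ → Finset X) : Prop where
  nonempty : ∀ n, (F n).Nonempty
  mono : Monotone F
  dense : Dense (⋃ n, (F n : Set X))

/-- The relation `F(X; p)`, computed from the sequence `F` of finite subsets of `X`, each with
the metric of `X`. -/
def FRel {X : Type*} [MetricSpace X] (F : ℕ → Finset X) (p : ℝ) (x y : ∀ n, {u // u ∈ F n}) :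
    Prop :=
  EllRel (fun n => {u // u ∈ F n}) p x y

/-- The chain condition link(`C`). -/
def Link (X : Type*) [MetricSpace X] (C : ℝ) : Prop :=
  ∀ ε : ℝ, 0 < ε → ∃ N : ℕ, 1 ≤ N ∧ ∀ u v : X, dist u v < C →
    ∃ r : ℕ → X, r 0 = u ∧ r N = v ∧ ∀ i < N, dist (r i) (r (i + 1)) < ε

/-- The underlying set of `ℓ_q((Y_n), y*)`. -/
def EllSpace (Y : ℕ → Type*) [∀ n, PseudoMetricSpace (Y n)] (q : ℝ) (ystar : ∀ n, Y n) : Type _ :=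
  {y : ∀ n, Y n // Summable fun n => dist (y n) (ystar n) ^ q}

namespace EllSpace

theorem triangle_aux {Y : ℕ → Type*} [∀ n, PseudoMetricSpace (Y n)] {q : ℝ} (hq : 1 ≤ q)
    {x y z : ∀ n, Y n} (hxy : Summable fun n => dist (x n) (y n) ^ q)
    (hyz : Summable fun n => dist (y n) (z n) ^ q) :
    (Summable fun n => dist (x n) (z n) ^ q) ∧
      (∑' n, dist (x n) (z n) ^ q) ^ (1 / q) ≤
        (∑' n, dist (x n) (y n) ^ q) ^ (1 / q) + (∑' n, dist (y n) (z n) ^ q) ^ (1 / q) := by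
  have h := Real.Lp_add_le_tsum_of_nonneg hq (fun n => dist_nonneg (x := x n) (y := y n))
    (fun n => dist_nonneg (x := y n) (y := z n)) hxy hyz
  have hle : ∀ n, dist (x n) (z n) ^ q ≤ (dist (x n) (y n) + dist (y n) (z n)) ^ q := fun n =>
    Real.rpow_le_rpow dist_nonneg (dist_triangle _ _ _) (by linarith)
  have hs : Summable fun n => dist (x n) (z n) ^ q :=
    Summable.of_nonneg_of_le (fun n => by positivity) hle h.1
  refine ⟨hs, le_trans ?_ h.2⟩
  exact Real.rpow_le_rpow (tsum_nonneg fun n => by positivity) (hs.tsum_le_tsum hle h.1)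
    (by positivity)

variable {Y : ℕ → Type*} [∀ n, PseudoMetricSpace (Y n)] {q : ℝ} {ystar : ∀ n, Y n}

theorem summable_dist (hq : 1 ≤ q) (x y : EllSpace Y q ystar) :
    Summable fun n => dist (x.1 n) (y.1 n) ^ q :=
  (triangle_aux hq x.2 (by simpa only [dist_comm] using y.2)).1

/-- The pseudo-metric `δ_q(x, y) = (∑ δ_n(x(n), y(n))^q)^(1/q)` of `ℓ_q((Y_n), y*)`. -/
noncomputable instance instPseudoMetricSpace [hq : Fact (1 ≤ q)] : PseudoMetricSpace (EllSpace Y q ystar) where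
  dist x y := (∑' n, dist (x.1 n) (y.1 n) ^ q) ^ (1 / q)
  dist_self x := by
    have h0 : q ≠ 0 := (zero_lt_one.trans_le hq.out).ne'
    simp [Real.zero_rpow h0, Real.zero_rpow (inv_ne_zero h0)]
  dist_comm x y := by simp only [dist_comm]
  dist_triangle x y z :=
    (triangle_aux hq.out (summable_dist hq.out x y) (summable_dist hq.out y z)).2

end EllSpace

/-- `X` can `C`-finitely Hölder(`α`) embed into `X'`; the constants `A`, `D` do not depend on the
finite subset `F`. -/
def FinitelyHolderEmbeds (X X' : Type*) [PseudoMetricSpace X] [PseudoMetricSpace X']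
    (C α : ℝ) : Prop :=
  ∃ A D : ℝ, 0 < A ∧ 0 < D ∧ ∀ F : Finset X, ∃ T : {u // u ∈ F} → X',
    ∀ u v : {u // u ∈ F},
      (C ≤ dist u v → D ≤ dist (T u) (T v)) ∧
      (dist u v < C →
        A⁻¹ * dist u v ^ α ≤ dist (T u) (T v) ∧ dist (T u) (T v) ≤ A * dist u v ^ α)

/-!
Modifying `x ∈ ∏ F_n` on finitely many coordinates changes a Borel reduction `θ` by a finite amount
in `ℓ_q`, and off a meager set `θ` is continuous and the tails of this amount are locally uniformly
small. Starting from a sufficiently generic point `z`, one can therefore pick sparse coordinates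
`c j` such that, for points `x` that differ from `z` only there, the `j`-th of a sequence of
consecutive blocks of `θ(x)` depends only on `x (c j)`, up to an error whose `q`-th power is
`O(2 ^ (-j))`. The blocks give maps `T j : F_{c j} → ℓ_q` such that, for every subsequence `f`, the
sums `∑ d(u_k, v_k)^p` and `∑ δ_q(T_{f k} u_k, T_{f k} v_k)^q` converge together.

Repeating pairs that violate a Hölder bound with suitable multiplicities would make exactly one of
these sums converge, so a lower Hölder bound and, at small distances, an upper one hold for all but
finitely many `j`. Chains from link(`C`) extend the upper bound to all distances below `C`, and
density of `⋃ F_n` transfers both bounds to arbitrary finite subsets of `X`.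
-/

open Filter Function Topology

section Subsequences

theorem exists_nat_mul_mem_Icc {s t : ℝ} (ht : 0 < t) (hts : t ≤ s) :
    ∃ r : ℕ, 0 < r ∧ r * t ∈ Set.Icc s (2 * s) := by
  have hst : 0 < s / t := div_pos (ht.trans_le hts) ht
  refine ⟨⌈s / t⌉₊, Nat.ceil_pos.2 hst, (div_le_iff₀ ht).1 (Nat.le_ceil _), ?_⟩
  calc ⌈s / t⌉₊ * t ≤ (s / t + 1) * t := by gcongr; exact (Nat.ceil_lt_add_one hst.le).le
    _ = s + t := by field_simp
    _ ≤ 2 * s := by linarith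

theorem exists_subsequence_with_multiplicities {Q : ℕ → ℕ → Prop} (hQ : ∀ m, ∃ᶠ j in atTop, Q m j)
    {r : ℕ → ℕ} (hr : ∀ m, 0 < r m) :
    ∃ f m : ℕ → ℕ, StrictMono f ∧ (∀ k, Q (m k) (f k)) ∧ ∀ g : ℕ → ℝ, (∀ n, 0 ≤ g n) →
      ((Summable fun k => g (m k)) ↔ Summable fun n => r n * g n) := by
  have : Infinite (Σ m, Fin (r m)) :=
    Infinite.of_injective (fun m => ⟨m, 0, hr m⟩) fun _ _ h => congrArg Sigma.fst h
  obtain ⟨e⟩ : Nonempty (ℕ ≃ Σ m, Fin (r m)) := nonempty_equiv_of_countable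
  obtain ⟨f, hf, hfQ⟩ := extraction_forall_of_frequently fun k => hQ (e k).1
  refine ⟨f, fun k => (e k).1, hf, hfQ, fun g hg => ?_⟩
  calc (Summable fun k => g (e k).1) ↔ Summable fun a : Σ m, Fin (r m) => g a.1 :=
        e.summable_iff (f := fun a : Σ m, Fin (r m) => g a.1)
    _ ↔ Summable fun n => r n * g n := by
        rw [summable_sigma_of_nonneg fun a => hg a.1]
        simpa using fun _ _ => Summable.of_finite

theorem not_summable_of_forall_one_le {g : ℕ → ℝ} (hg : ∀ n, 1 ≤ g n) : ¬ Summable g := fun h =>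
  absurd (ge_of_tendsto' h.tendsto_atTop_zero hg) (by norm_num)

theorem summable_two_mul_half_pow : Summable fun m : ℕ => 2 * (1 / 2 : ℝ) ^ m :=
  summable_geometric_two.mul_left 2

variable {ι : Type*} {a : ι → ℝ} {b : ℕ → ι → ℝ} {P : ℕ → ι → Prop}

/-- If `b j i > 2 ^ m * a i` for infinitely many `j` and a suitable `i = i m` with `a i` tiny, then
repeating `i m` about `2 ^ (-m) / a i` times makes the `a`-sum finite and the `b`-sum infinite. -/
theorem exists_eventually_le_mul_of_summable (hP : ∀ i, ∀ᶠ j in atTop, P j i)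
    (h : ∀ f : ℕ → ℕ, StrictMono f → ∀ i : ℕ → ι, (∀ k, P (f k) (i k)) →
      (Summable fun k => a (i k)) → Summable fun k => b (f k) (i k)) :
    ∃ B > 0, ∃ η > 0, ∀ i, 0 < a i → a i < η → ∀ᶠ j in atTop, b j i ≤ B * a i := by
  by_contra! hcon
  choose i ha_pos ha_lt hfreq using fun m : ℕ =>
    hcon (2 ^ m) (by positivity) ((1 / 2) ^ m) (by positivity)
  choose r hr hr_mem using fun m => exists_nat_mul_mem_Icc (ha_pos m) (ha_lt m).le
  obtain ⟨f, m, hf, hQ, hsum⟩ := exists_subsequence_with_multiplicities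
    (fun m => (hfreq m).and_eventually (hP (i m))) hr
  have ha_sum : Summable fun k => a (i (m k)) :=
    (hsum (fun n => a (i n)) fun n => (ha_pos n).le).2 <|
      summable_two_mul_half_pow.of_nonneg_of_le
        (fun n => mul_nonneg (Nat.cast_nonneg _) (ha_pos n).le) fun n => (hr_mem n).2
  have hb_sum := h f hf (fun k => i (m k)) (fun k => (hQ k).2) ha_sum
  have hpow_pos : ∀ n, 0 ≤ 2 ^ n * a (i n) := fun n => mul_nonneg (by positivity) (ha_pos n).le
  have hpow_sum : Summable fun n => r n * (2 ^ n * a (i n)) :=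
    (hsum (fun n => 2 ^ n * a (i n)) hpow_pos).1 <|
      hb_sum.of_nonneg_of_le (fun k => hpow_pos (m k)) fun k => (hQ k).1.le
  refine not_summable_of_forall_one_le (fun n => ?_) hpow_sum
  calc (1 : ℝ) = 2 ^ n * (1 / 2) ^ n := by rw [← mul_pow]; norm_num
    _ ≤ 2 ^ n * (r n * a (i n)) := by gcongr; exact (hr_mem n).1
    _ = r n * (2 ^ n * a (i n)) := by ring

theorem exists_eventually_mul_min_le_of_summable (hP : ∀ i, ∀ᶠ j in atTop, P j i)
    (hb : ∀ j i, 0 ≤ b j i)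
    (h : ∀ f : ℕ → ℕ, StrictMono f → ∀ i : ℕ → ι, (∀ k, P (f k) (i k)) →
      (Summable fun k => b (f k) (i k)) → Summable fun k => a (i k)) :
    ∃ c > 0, ∀ i, ∀ᶠ j in atTop, c * min (a i) 1 ≤ b j i := by
  by_contra! hcon
  choose i hfreq using fun m : ℕ => hcon ((1 / 2) ^ m) (by positivity)
  have hmin_pos : ∀ m, 0 < min (a (i m)) 1 := fun m => by
    obtain ⟨j, hj⟩ := (hfreq m).exists
    exact pos_of_mul_pos_right ((hb j (i m)).trans_lt hj) (by positivity)
  choose r hr hr_mem using fun m => exists_nat_mul_mem_Icc (hmin_pos m) (min_le_right (a (i m)) 1)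
  obtain ⟨f, m, hf, hQ, hsum⟩ := exists_subsequence_with_multiplicities
    (fun m => (hfreq m).and_eventually (hP (i m))) hr
  have hpow_pos : ∀ n : ℕ, 0 ≤ (1 / 2) ^ n * min (a (i n)) 1 := fun n =>
    mul_nonneg (by positivity) (hmin_pos n).le
  have hpow_sum : Summable fun k => (1 / 2) ^ m k * min (a (i (m k))) 1 := by
    refine (hsum (fun n => (1 / 2) ^ n * min (a (i n)) 1) hpow_pos).2 <|
      summable_two_mul_half_pow.of_nonneg_of_le
        (fun n => mul_nonneg (Nat.cast_nonneg _) (hpow_pos n)) fun n => ?_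
    calc r n * ((1 / 2) ^ n * min (a (i n)) 1) = (1 / 2) ^ n * (r n * min (a (i n)) 1) := by ring
      _ ≤ (1 / 2) ^ n * (2 * 1) := mul_le_mul_of_nonneg_left (hr_mem n).2 (by positivity)
      _ = 2 * (1 / 2) ^ n := by ring
  have hb_sum : Summable fun k => b (f k) (i (m k)) :=
    hpow_sum.of_nonneg_of_le (fun k => hb _ _) fun k => (hQ k).1.le
  have ha_sum := h f hf (fun k => i (m k)) (fun k => (hQ k).2) hb_sum
  have ha_pos : ∀ n, 0 < a (i n) := fun n => (lt_min_iff.1 (hmin_pos n)).1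
  refine not_summable_of_forall_one_le (fun n => ?_)
    ((hsum (fun n => a (i n)) fun n => (ha_pos n).le).1 ha_sum)
  exact (hr_mem n).1.trans (by gcongr; exact min_le_left _ _)

end Subsequences

section Metric

variable {X E : Type*} [PseudoMetricSpace E] {p q C α : ℝ} {G : ℕ → Set X} {S : Set X}

/-- Along every subsequence, the maps `T j` on `G j` reduce the convergence of `∑ d(u_k, v_k)^p` to
that of `∑ d(T_{f k} u_k, T_{f k} v_k)^q`. Each `T j` is defined on all of `X`, but only its values
on `G j` matter. -/
def SubsequentiallyReduces [PseudoMetricSpace X] (G : ℕ → Set X) (T : ℕ → X → E) (p q : ℝ) : Prop :=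
  ∀ f : ℕ → ℕ, StrictMono f → ∀ u v : ℕ → X, (∀ k, u k ∈ G (f k) ∧ v k ∈ G (f k)) →
    ((Summable fun k => dist (u k) (v k) ^ p) ↔
      Summable fun k => dist (T (f k) (u k)) (T (f k) (v k)) ^ q)

theorem SubsequentiallyReduces.exists_eventually_dist_le [MetricSpace X] {T : ℕ → X → E}
    (hT : SubsequentiallyReduces G T p q) (hG : ∀ u ∈ S, ∀ᶠ j in atTop, u ∈ G j)
    (hp : 0 < p) (hq : 0 < q) :
    ∃ B > 0, ∃ η > 0, ∀ u ∈ S, ∀ v ∈ S, dist u v < η →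
      ∀ᶠ j in atTop, dist (T j u) (T j v) ≤ B * dist u v ^ (p / q) := by
  obtain ⟨B, hB, η, hη, h⟩ := exists_eventually_le_mul_of_summable (ι := S × S)
    (a := fun i => dist i.1 i.2 ^ p) (b := fun j i => dist (T j i.1) (T j i.2) ^ q)
    (P := fun j i => ↑i.1 ∈ G j ∧ ↑i.2 ∈ G j)
    (fun i => (hG i.1 i.1.2).and (hG i.2 i.2.2))
    (fun f hf i hi => (hT f hf (fun k => (i k).1) (fun k => (i k).2) hi).1)
  refine ⟨B ^ q⁻¹, by positivity, η ^ p⁻¹, by positivity, fun u hu v hv huv => ?_⟩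
  rcases eq_or_ne u v with rfl | hne
  · exact .of_forall fun j => by rw [dist_self (T j u)]; positivity
  filter_upwards [h (⟨u, hu⟩, ⟨v, hv⟩) (Real.rpow_pos_of_pos (dist_pos.2 hne) p)
    ((Real.lt_rpow_inv_iff_of_pos dist_nonneg hη.le hp).1 huv)] with j hj
  calc dist (T j u) (T j v) ≤ (B * dist u v ^ p) ^ q⁻¹ :=
        (Real.le_rpow_inv_iff_of_pos dist_nonneg (by positivity) hq).2 hj
    _ = B ^ q⁻¹ * dist u v ^ (p / q) := by
        rw [Real.mul_rpow hB.le (by positivity), ← Real.rpow_mul dist_nonneg, div_eq_mul_inv]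

theorem SubsequentiallyReduces.exists_eventually_le_dist [PseudoMetricSpace X] {T : ℕ → X → E}
    (hT : SubsequentiallyReduces G T p q) (hG : ∀ u ∈ S, ∀ᶠ j in atTop, u ∈ G j)
    (hp : 0 ≤ p) (hq : 0 < q) :
    ∃ a > 0, ∀ u ∈ S, ∀ v ∈ S,
      ∀ᶠ j in atTop, a * min (dist u v) 1 ^ (p / q) ≤ dist (T j u) (T j v) := by
  obtain ⟨a, ha, h⟩ := exists_eventually_mul_min_le_of_summable (ι := S × S)
    (a := fun i => dist i.1 i.2 ^ p) (b := fun j i => dist (T j i.1) (T j i.2) ^ q)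
    (P := fun j i => ↑i.1 ∈ G j ∧ ↑i.2 ∈ G j)
    (fun i => (hG i.1 i.1.2).and (hG i.2 i.2.2)) (fun j i => by positivity)
    (fun f hf i hi => (hT f hf (fun k => (i k).1) (fun k => (i k).2) hi).2)
  refine ⟨a ^ q⁻¹, by positivity, fun u hu v hv => ?_⟩
  have hmin : 0 ≤ min (dist u v) 1 := le_min dist_nonneg zero_le_one
  filter_upwards [h (⟨u, hu⟩, ⟨v, hv⟩)] with j hj
  calc a ^ q⁻¹ * min (dist u v) 1 ^ (p / q) = (a * min (dist u v) 1 ^ p) ^ q⁻¹ := by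
        rw [Real.mul_rpow ha.le (by positivity), ← Real.rpow_mul hmin, div_eq_mul_inv]
    _ ≤ dist (T j u) (T j v) := by
        refine (Real.rpow_inv_le_iff_of_pos (by positivity) dist_nonneg hq).2 (le_trans ?_ hj)
        gcongr
        exact le_min (by gcongr; exact min_le_left _ _)
          (Real.rpow_le_one hmin (min_le_right _ _) hp)

theorem dist_le_mul_of_chain [PseudoMetricSpace X] {T : X → E} {B d : ℝ} (hB : 0 ≤ B)
    (hα : 0 ≤ α) {N : ℕ} {r : ℕ → X}
    (hr : ∀ i < N, dist (r i) (r (i + 1)) ≤ d)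
    (hT : ∀ i < N, dist (T (r i)) (T (r (i + 1))) ≤ B * dist (r i) (r (i + 1)) ^ α) :
    dist (T (r 0)) (T (r N)) ≤ N * B * d ^ α := by
  calc dist (T (r 0)) (T (r N)) ≤ ∑ i ∈ Finset.range N, dist (T (r i)) (T (r (i + 1))) :=
        dist_le_range_sum_dist (fun i => T (r i)) N
    _ ≤ ∑ _i ∈ Finset.range N, B * d ^ α := by
        refine Finset.sum_le_sum fun i hi => ?_
        have hi := Finset.mem_range.1 hi
        exact (hT i hi).trans (by gcongr; exact hr i hi)
    _ = N * B * d ^ α := by simp [mul_assoc]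

variable [MetricSpace X]

theorem Link.exists_chain_mem_dense (hlink : Link X C) (hS : Dense S) {η : ℝ} (hη : 0 < η) :
    ∃ N : ℕ, ∀ u ∈ S, ∀ v ∈ S, dist u v < C →
      ∃ r : ℕ → X, r 0 = u ∧ r N = v ∧ (∀ i, r i ∈ S) ∧ ∀ i < N, dist (r i) (r (i + 1)) < η := by
  obtain ⟨N, -, hN⟩ := hlink (η / 3) (by positivity)
  refine ⟨N, fun u hu v hv huv => ?_⟩
  obtain ⟨r, rfl, rfl, hr⟩ := hN u v huv
  have happrox : ∀ x, ∃ s ∈ S, dist x s < η / 3 ∧ (x ∈ S → s = x) := fun x => by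
    by_cases hx : x ∈ S
    · exact ⟨x, hx, by simpa using hη, fun _ => rfl⟩
    · obtain ⟨s, hs, hxs⟩ := hS.exists_dist_lt x (by positivity : 0 < η / 3)
      exact ⟨s, hs, hxs, fun h => absurd h hx⟩
  choose s hsS hs hs_eq using happrox
  refine ⟨fun i => s (r i), hs_eq _ hu, hs_eq _ hv, fun i => hsS _, fun i hi => ?_⟩
  calc dist (s (r i)) (s (r (i + 1)))
      ≤ dist (s (r i)) (r i) + dist (r i) (r (i + 1)) + dist (r (i + 1)) (s (r (i + 1))) :=
        dist_triangle4 _ _ _ _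
    _ < η / 3 + η / 3 + η / 3 := by
        rw [dist_comm (s (r i))]
        exact add_lt_add (add_lt_add (hs _) (hr i hi)) (hs _)
    _ = η := by ring

variable {ι : Type*} {l : Filter ι} {T : ι → X → E}

theorem Link.exists_eventually_dist_le (hlink : Link X C) (hS : Dense S) (hα : 0 ≤ α)
    {B η : ℝ} (hB : 0 < B) (hη : 0 < η)
    (hlocal : ∀ u ∈ S, ∀ v ∈ S, dist u v < η →
      ∀ᶠ j in l, dist (T j u) (T j v) ≤ B * dist u v ^ α) :
    ∃ B' > 0, ∀ u ∈ S, ∀ v ∈ S, dist u v < C →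
      ∀ᶠ j in l, dist (T j u) (T j v) ≤ B' * dist u v ^ α := by
  obtain ⟨N, hN⟩ := hlink.exists_chain_mem_dense hS hη
  refine ⟨max B (N * B), lt_max_of_lt_left hB, fun u hu v hv huv => ?_⟩
  rcases lt_or_ge (dist u v) η with hlt | hge
  · filter_upwards [hlocal u hu v hv hlt] with j hj
    exact hj.trans (by gcongr; exact le_max_left _ _)
  · obtain ⟨r, rfl, rfl, hrS, hr⟩ := hN u hu v hv huv
    filter_upwards [(Finset.eventually_all (Finset.range N)).2 fun i hi =>
      hlocal _ (hrS i) _ (hrS (i + 1)) (hr i (Finset.mem_range.1 hi))] with j hj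
    have hchain := dist_le_mul_of_chain hB.le hα (fun i hi => (hr i hi).le.trans hge)
      fun i hi => hj i (Finset.mem_range.2 hi)
    exact hchain.trans (by gcongr; exact le_max_right _ _)

theorem exists_mem_dense_dist_comparable (hS : Dense S) (C : ℝ) (F : Finset X) :
    ∃ s : X → X, (∀ u, s u ∈ S) ∧ ∀ u ∈ F, ∀ v ∈ F,
      dist u v / 2 ≤ dist (s u) (s v) ∧ dist (s u) (s v) ≤ 2 * dist u v ∧
        (dist u v < C → dist (s u) (s v) < C) := by
  choose s hsS hs using fun u => mem_closure_iff_seq_limit.1 (hS u)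
  have hev : ∀ᶠ n in atTop, ∀ u ∈ F, ∀ v ∈ F,
      dist u v / 2 ≤ dist (s u n) (s v n) ∧ dist (s u n) (s v n) ≤ 2 * dist u v ∧
        (dist u v < C → dist (s u n) (s v n) < C) := by
    refine (Finset.eventually_all F).2 fun u _ => (Finset.eventually_all F).2 fun v _ => ?_
    rcases eq_or_ne u v with rfl | hne
    · simp
    have hlim := (hs u).dist (hs v)
    have hpos := dist_pos.2 hne
    exact (hlim.eventually_const_le (half_lt_self hpos)).and <|
      (hlim.eventually_le_const (by linarith)).and <|
        eventually_imp_distrib_left.2 hlim.eventually_lt_const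
  obtain ⟨n, hn⟩ := hev.exists
  exact ⟨fun u => s u n, fun u => hsS u n, hn⟩

theorem min_half_one_div_mul_le_min {C d e : ℝ} (hC : 0 < C) (hd : 0 ≤ d) (hdC : d ≤ C)
    (hde : d / 2 ≤ e) : min (C / 2) 1 / C * d ≤ min e 1 := by
  have hdC' : d / C ≤ 1 := (div_le_one hC).2 hdC
  refine le_min (le_trans ?_ hde) ?_
  · calc min (C / 2) 1 / C * d ≤ C / 2 / C * d := by gcongr; exact min_le_left _ _
      _ = d / 2 := by field_simp
  · calc min (C / 2) 1 / C * d = min (C / 2) 1 * (d / C) := by ring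
      _ ≤ 1 := mul_le_one₀ (min_le_right _ _) (by positivity) hdC'

theorem finitelyHolderEmbeds_of_eventually [l.NeBot] (hS : Dense S) (hC : 0 < C) (hα : 0 < α)
    {a B : ℝ} (ha : 0 < a) (hB : 0 < B)
    (hlower : ∀ u ∈ S, ∀ v ∈ S, ∀ᶠ j in l, a * min (dist u v) 1 ^ α ≤ dist (T j u) (T j v))
    (hupper : ∀ u ∈ S, ∀ v ∈ S, dist u v < C →
      ∀ᶠ j in l, dist (T j u) (T j v) ≤ B * dist u v ^ α) :
    FinitelyHolderEmbeds X E C α := by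
  set μ := min (C / 2) 1
  have : 0 < μ := lt_min (by positivity) one_pos
  refine ⟨max (B * 2 ^ α) (a * (μ / C) ^ α)⁻¹, a * μ ^ α, lt_max_of_lt_left (by positivity),
    by positivity, fun F => ?_⟩
  obtain ⟨s, hsS, hs⟩ := exists_mem_dense_dist_comparable hS C F
  obtain ⟨j, hj⟩ := ((Finset.eventually_all F).2 fun u _ => (Finset.eventually_all F).2 fun v _ =>
    (hlower (s u) (hsS u) (s v) (hsS v)).and
      (eventually_imp_distrib_left.2 (hupper (s u) (hsS u) (s v) (hsS v)))).exists
  refine ⟨fun u => T j (s u), fun ⟨u, hu⟩ ⟨v, hv⟩ => ?_⟩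
  obtain ⟨hs_ge, hs_le, hs_lt⟩ := hs u hu v hv
  obtain ⟨hT_ge, hT_le⟩ := hj u hu v hv
  rw [Subtype.dist_eq]
  set d := dist u v
  have hd : 0 ≤ d := dist_nonneg
  refine ⟨fun hCd => le_trans ?_ hT_ge,
    fun hdC => ⟨le_trans ?_ hT_ge, (hT_le (hs_lt hdC)).trans ?_⟩⟩
  · gcongr
    exact min_le_min_right _ (by linarith)
  · have hμd : μ / C * d ≤ min (dist (s u) (s v)) 1 :=
      min_half_one_div_mul_le_min hC hd hdC.le hs_ge
    calc (max (B * 2 ^ α) (a * (μ / C) ^ α)⁻¹)⁻¹ * d ^ α ≤ a * (μ / C) ^ α * d ^ α := by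
          gcongr
          exact inv_le_of_inv_le₀ (by positivity) (le_max_right _ _)
      _ = a * (μ / C * d) ^ α := by rw [Real.mul_rpow (by positivity) hd, mul_assoc]
      _ ≤ a * min (dist (s u) (s v)) 1 ^ α := by gcongr
  · calc B * dist (s u) (s v) ^ α ≤ B * (2 * d) ^ α := by gcongr
      _ = B * 2 ^ α * d ^ α := by rw [Real.mul_rpow two_pos.le hd, mul_assoc]
      _ ≤ max (B * 2 ^ α) (a * (μ / C) ^ α)⁻¹ * d ^ α := by gcongr; exact le_max_left _ _

theorem SubsequentiallyReduces.finitelyHolderEmbeds {T : ℕ → X → E}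
    (hT : SubsequentiallyReduces G T p q) (hS : Dense S) (hG : ∀ u ∈ S, ∀ᶠ j in atTop, u ∈ G j)
    (hp : 0 < p) (hq : 0 < q) (hC : 0 < C) (hlink : Link X C) :
    FinitelyHolderEmbeds X E C (p / q) := by
  have hα : 0 < p / q := by positivity
  obtain ⟨a, ha, hlower⟩ := hT.exists_eventually_le_dist hG hp.le hq
  obtain ⟨B, hB, η, hη, hlocal⟩ := hT.exists_eventually_dist_le hG hp hq
  obtain ⟨B', hB', hupper⟩ := hlink.exists_eventually_dist_le hS hα.le hB hη hlocal
  exact finitelyHolderEmbeds_of_eventually hS hC hα ha hB' hlower hupper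

end Metric

section Baire

theorem exists_residual_forall_eventually_mem {P ι : Type*} [TopologicalSpace P]
    [MeasurableSpace P] [BorelSpace P] [Countable ι] {V : ι → Set P}
    (hV : ∀ i, MeasurableSet (V i)) :
    ∃ R ∈ residual P, ∀ i, ∀ x ∈ R, x ∈ V i → ∀ᶠ w in 𝓝[R] x, w ∈ V i := by
  choose U hU_open hU using fun i => (hV i).residualEq_isOpen
  refine ⟨{x | ∀ i, x ∈ V i ↔ x ∈ U i}, eventually_countable_forall.2 fun i => (hU i).mem_iff,
    fun i x hx hxV => ?_⟩
  filter_upwards [self_mem_nhdsWithin,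
    mem_nhdsWithin_of_mem_nhds ((hU_open i).mem_nhds ((hx i).1 hxV))] with w hw hwU
  exact (hw i).2 hwU

theorem exists_residual_continuousOn_of_measurable {P Z : Type*} [TopologicalSpace P]
    [MeasurableSpace P] [BorelSpace P] [TopologicalSpace Z] [SecondCountableTopology Z]
    [MeasurableSpace Z] [OpensMeasurableSpace Z] {f : P → Z} (hf : Measurable f) :
    ∃ R ∈ residual P, ContinuousOn f R := by
  have hB := TopologicalSpace.isBasis_countableBasis Z
  have := (TopologicalSpace.countable_countableBasis Z).to_subtype
  obtain ⟨R, hR, h⟩ := exists_residual_forall_eventually_mem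
    (V := fun i : TopologicalSpace.countableBasis Z => f ⁻¹' i)
    fun i => hf (hB.isOpen i.2).measurableSet
  refine ⟨R, hR, fun x hx => hB.nhds_hasBasis.tendsto_right_iff.2 fun s hs => ?_⟩
  exact h ⟨s, hs.1⟩ x hx hs.2

end Baire

section FiniteModification

variable {ι : Type*} [DecidableEq ι] {A : ι → Type*} [∀ i, TopologicalSpace (A i)]

theorem continuous_updateFinset_left (s : Finset ι) (r : ∀ i : s, A i) :
    Continuous fun x : ∀ i, A i => updateFinset x s r := by
  refine continuous_pi fun i => ?_
  by_cases hi : i ∈ s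
  · simpa only [updateFinset, hi, dite_true] using continuous_const
  · simpa only [updateFinset, hi, dite_false] using continuous_apply i

theorem isOpenMap_updateFinset_left [∀ i, DiscreteTopology (A i)] (s : Finset ι)
    (r : ∀ i : s, A i) : IsOpenMap fun x : ∀ i, A i => updateFinset x s r := by
  intro U hU
  have himage : (fun x : ∀ i, A i => updateFinset x s r) '' U =
      s.restrict ⁻¹' {r} ∩ ⋃ r', (fun y => updateFinset y s r') ⁻¹' U := by
    ext y
    simp only [Set.mem_image, Set.mem_inter_iff, Set.mem_preimage, Set.mem_singleton_iff,
      Set.mem_iUnion]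
    constructor
    · rintro ⟨x, hx, rfl⟩
      refine ⟨restrict_updateFinset x r, s.restrict x, ?_⟩
      rwa [updateFinset_updateFinset_of_subset subset_rfl, updateFinset_restrict]
    · rintro ⟨rfl, r', hr'⟩
      refine ⟨_, hr', ?_⟩
      rw [updateFinset_updateFinset_of_subset subset_rfl, updateFinset_restrict]
  rw [himage]
  exact ((isOpen_discrete {r}).preimage (Finset.continuous_restrict s)).inter <|
    isOpen_iUnion fun r' => hU.preimage (continuous_updateFinset_left s r')

theorem exists_forall_updateFinset_mem_of_residual [Countable ι] [∀ i, DiscreteTopology (A i)]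
    [∀ i, Countable (A i)] [∀ i, Nonempty (A i)] [BaireSpace (∀ i, A i)]
    {R : Set (∀ i, A i)} (hR : R ∈ residual (∀ i, A i)) :
    ∃ z, ∀ (s : Finset ι) (r : ∀ i : s, A i), updateFinset z s r ∈ R := by
  have hev : ∀ᶠ z in residual (∀ i, A i), ∀ (s : Finset ι) (r : ∀ i : s, A i),
      updateFinset z s r ∈ R :=
    eventually_countable_forall.2 fun s => eventually_countable_forall.2 fun r =>
      tendsto_residual_of_isOpenMap (continuous_updateFinset_left s r)
        (isOpenMap_updateFinset_left s r) hR
  exact (dense_of_mem_residual hev).nonempty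

end FiniteModification

section Fusion

variable {A : ℕ → Type*} [∀ n, Finite (A n)] [∀ n, TopologicalSpace (A n)]
  [∀ n, DiscreteTopology (A n)] {z : ∀ n, A n}

theorem eventually_forall_of_eventually_nhds_updateFinset {k : ℕ}
    {P : (∀ i : Finset.range k, A i) → (∀ n, A n) → Prop}
    (hP : ∀ r, ∀ᶠ w in 𝓝 (updateFinset z (Finset.range k) r), P r w) :
    ∀ᶠ M in atTop, ∀ w : ∀ n, A n, (∀ n ∈ Set.Ico k M, w n = z n) →
      P ((Finset.range k).restrict w) w := by
  have hev : ∀ᶠ M in atTop, ∀ (r : ∀ i : Finset.range k, A i) (w : ∀ n, A n),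
      (∀ n < M, w n = updateFinset z (Finset.range k) r n) → P r w := by
    refine eventually_all.2 fun r => ?_
    obtain ⟨_, ⟨y, m, rfl⟩, hy, hsub⟩ :=
      (PiNat.isTopologicalBasis_cylinders A).mem_nhds_iff.1 (hP r)
    filter_upwards [eventually_ge_atTop m] with M hM w hw
    exact hsub fun i hi => (hw i (hi.trans_le hM)).trans (hy i hi)
  filter_upwards [hev] with M hM w hw
  refine hM _ w fun n hn => ?_
  by_cases hnk : n < k
  · simp [updateFinset, hnk]
  · simp [updateFinset, hnk, hw n ⟨not_lt.1 hnk, hn⟩]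

theorem eventually_forall_mem_of_isOpen {U : Set (∀ n, A n)} (hU : IsOpen U)
    (hz : ∀ (s : Finset ℕ) r, updateFinset z s r ∈ U) (k : ℕ) :
    ∀ᶠ M in atTop, ∀ w : ∀ n, A n, (∀ n ∈ Set.Ico k M, w n = z n) → w ∈ U :=
  eventually_forall_of_eventually_nhds_updateFinset fun r => hU.mem_nhds (hz _ r)

/-- The free coordinates `c j` are placed so far apart that the block `[k j, c j)`, on which every
such `w` agrees with `z`, already forces `w` into `Q (k j) (l j)`. -/
theorem exists_sparse_coordinates {R : Set (∀ n, A n)} (hR : IsGδ R)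
    (hz : ∀ (s : Finset ℕ) r, updateFinset z s r ∈ R) {Q : ℕ → ℕ → Set (∀ n, A n)}
    (hQ : ∀ k, ∀ᶠ l in atTop, ∀ᶠ M in atTop, ∀ w ∈ R, (∀ n ∈ Set.Ico k M, w n = z n) →
      w ∈ Q k l) :
    ∃ k c l : ℕ → ℕ, StrictMono l ∧ (∀ j, k j ≤ c j ∧ k (j + 1) = c j + 1) ∧
      ∀ w, (∀ n ∉ Set.range c, w n = z n) →
        ∀ j, (∀ n ∈ Set.Ico (k j) (c j), w n = z n) ∧ w ∈ Q (k j) (l j) := by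
  obtain ⟨O, hO, rfl⟩ := hR.eq_iInter_nat
  choose l hl using fun k => ((hQ k).and (eventually_ge_atTop k)).exists
  have hO_ev : ∀ k, ∀ᶠ M in atTop, ∀ i ∈ Finset.range (k + 1), ∀ w : ∀ n, A n,
      (∀ n ∈ Set.Ico k M, w n = z n) → w ∈ O i := fun k =>
    (Finset.eventually_all _).2 fun i _ =>
      eventually_forall_mem_of_isOpen (hO i) (fun s r => Set.mem_iInter.1 (hz s r) i) k
  choose H hH using fun k =>
    (((hl k).1.and (hO_ev k)).and (eventually_ge_atTop (l k))).exists
  have : ∀ k, k ≤ l k ∧ l k ≤ H k := fun k => ⟨(hl k).2, (hH k).2⟩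
  set k : ℕ → ℕ := fun j => (fun n => H n + 1)^[j] 0
  have hk_succ : ∀ j, k (j + 1) = H (k j) + 1 := fun j => Function.iterate_succ_apply' ..
  have hk : StrictMono k := strictMono_nat_of_lt_succ fun j => by grind
  refine ⟨k, fun j => H (k j), fun j => l (k j), strictMono_nat_of_lt_succ fun j => by grind,
    fun j => ⟨by grind, hk_succ j⟩, fun w hw => ?_⟩
  have hwz : ∀ j, ∀ n ∈ Set.Ico (k j) (H (k j)), w n = z n := by
    refine fun j n hn => hw n ?_
    rintro ⟨i, rfl⟩
    have hlt : j < i + 1 := hk.lt_iff_lt.1 (by grind)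
    have hgt : i + 1 < j + 1 := hk.lt_iff_lt.1 (by grind)
    omega
  have hwR : w ∈ ⋂ i, O i := Set.mem_iInter.2 fun i =>
    (hH (k i)).1.2 i (Finset.mem_range_succ_iff.2 hk.le_apply) w (hwz i)
  exact fun j => ⟨hwz j, (hH (k j)).1.1 w hwR (hwz j)⟩

end Fusion

section EllSum

variable {Y : ℕ → Type*} [∀ n, PseudoMetricSpace (Y n)] {q : ℝ} {x x' y y' z : ∀ n, Y n}

/-- The `q`-th power of the `ℓ_q`-distance of `x` and `y` over the finite index set `s`. -/
noncomputable def ellSum (q : ℝ) (s : Finset ℕ) (x y : ∀ n, Y n) : ℝ :=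
  ∑ n ∈ s, dist (x n) (y n) ^ q

theorem ellSum_nonneg (s : Finset ℕ) (x y : ∀ n, Y n) : 0 ≤ ellSum q s x y :=
  Finset.sum_nonneg fun _ _ => by positivity

theorem ellSum_mono {s t : Finset ℕ} (h : s ⊆ t) (x y : ∀ n, Y n) :
    ellSum q s x y ≤ ellSum q t x y :=
  Finset.sum_le_sum_of_subset_of_nonneg h fun _ _ _ => by positivity

theorem dist_rpow_le_two_rpow_mul {M : Type*} [PseudoMetricSpace M] (hq : 0 ≤ q) (a b c : M) :
    dist a c ^ q ≤ 2 ^ q * (dist a b ^ q + dist b c ^ q) := by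
  have hmax : 0 ≤ max (dist a b) (dist b c) := le_max_of_le_left dist_nonneg
  calc dist a c ^ q ≤ (2 * max (dist a b) (dist b c)) ^ q := by
        gcongr
        linarith [dist_triangle a b c, le_max_left (dist a b) (dist b c),
          le_max_right (dist a b) (dist b c)]
    _ = 2 ^ q * max (dist a b ^ q) (dist b c ^ q) := by
        rw [Real.mul_rpow two_pos.le hmax, Real.rpow_max dist_nonneg dist_nonneg hq]
    _ ≤ 2 ^ q * (dist a b ^ q + dist b c ^ q) := by
        gcongr
        exact max_le_add_of_nonneg (by positivity) (by positivity)

theorem ellSum_triangle (hq : 0 ≤ q) (s : Finset ℕ) (x y z : ∀ n, Y n) :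
    ellSum q s x z ≤ 2 ^ q * (ellSum q s x y + ellSum q s y z) := by
  rw [ellSum, ellSum, ellSum, ← Finset.sum_add_distrib, Finset.mul_sum]
  exact Finset.sum_le_sum fun n _ => dist_rpow_le_two_rpow_mul hq _ _ _

theorem EllRel.symm (h : EllRel Y q x y) : EllRel Y q y x := by
  simpa only [EllRel, dist_comm] using h

theorem EllRel.trans (hq : 1 ≤ q) (hxy : EllRel Y q x y) (hyz : EllRel Y q y z) : EllRel Y q x z :=
  (EllSpace.triangle_aux hq hxy hyz).1

theorem EllRel.congr (hq : 1 ≤ q) (hx : EllRel Y q x x') (hy : EllRel Y q y y') :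
    EllRel Y q x y ↔ EllRel Y q x' y' :=
  ⟨fun h => (hx.symm.trans hq h).trans hq hy, fun h => (hx.trans hq h).trans hq hy.symm⟩

theorem EllRel.of_eventually_eq (hq : q ≠ 0) (h : ∀ᶠ n in cofinite, x n = y n) : EllRel Y q x y :=
  summable_of_hasFiniteSupport <| eventually_cofinite.1 <| h.mono fun n hn => by
    simp only [hn, dist_self, Real.zero_rpow hq]

theorem eventually_forall_sum_Ico_le {f : ℕ → ℝ} (hf : ∀ n, 0 ≤ f n) (hs : Summable f) {ε : ℝ}
    (hε : 0 < ε) : ∀ᶠ l in atTop, ∀ N, ∑ n ∈ Finset.Ico l N, f n ≤ ε := by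
  filter_upwards [(tendsto_sum_nat_add f).eventually_le_const hε] with l hl N
  rw [Finset.sum_Ico_eq_sum_range]
  simp only [add_comm l]
  exact (((summable_nat_add_iff l).2 hs).sum_le_tsum _ fun _ _ => hf _).trans hl

theorem summable_iff_summable_sum_Ico {f : ℕ → ℝ} (hf : ∀ n, 0 ≤ f n) {l : ℕ → ℕ}
    (hl : StrictMono l) :
    Summable f ↔ Summable fun j => ∑ n ∈ Finset.Ico (l j) (l (j + 1)), f n := by
  have hblock_nonneg : ∀ j, 0 ≤ ∑ n ∈ Finset.Ico (l j) (l (j + 1)), f n := fun j =>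
    Finset.sum_nonneg fun n _ => hf n
  have hsum : ∀ J, ∑ n ∈ Finset.range (l 0), f n +
      ∑ j ∈ Finset.range J, ∑ n ∈ Finset.Ico (l j) (l (j + 1)), f n =
        ∑ n ∈ Finset.range (l J), f n := fun J => by
    induction J with
    | zero => simp
    | succ J ih =>
      rw [Finset.sum_range_succ, ← add_assoc, ih,
        Finset.sum_range_add_sum_Ico _ (hl.monotone J.le_succ)]
  have hrange_nonneg : 0 ≤ ∑ n ∈ Finset.range (l 0), f n := Finset.sum_nonneg fun n _ => hf n
  constructor <;> intro h
  · refine summable_of_sum_range_le (c := ∑' n, f n) hblock_nonneg fun J => ?_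
    linarith [hsum J, h.sum_le_tsum (Finset.range (l J)) fun n _ => hf n]
  · refine summable_of_sum_range_le (c := ∑ n ∈ Finset.range (l 0), f n +
      ∑' j, ∑ n ∈ Finset.Ico (l j) (l (j + 1)), f n) hf fun N => ?_
    have hmono : ∑ n ∈ Finset.range N, f n ≤ ∑ n ∈ Finset.range (l N), f n :=
      Finset.sum_le_sum_of_subset_of_nonneg (Finset.range_mono hl.le_apply) fun n _ _ => hf n
    linarith [hsum N, h.sum_le_tsum (Finset.range N) fun j _ => hblock_nonneg j]

variable [hq : Fact (1 ≤ q)] (ystar : ∀ n, Y n)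

/-- The point of `ℓ_q((Y_n), y*)` that agrees with `y` on the finite set `s` and with `y*`
elsewhere. -/
noncomputable def EllSpace.ofFinset (s : Finset ℕ) (y : ∀ n, Y n) : EllSpace Y q ystar :=
  ⟨updateFinset ystar s (s.restrict y), EllRel.of_eventually_eq (zero_lt_one.trans_le hq.out).ne' <|
    s.eventually_cofinite_notMem.mono fun n hn => by simp_all only [updateFinset, dite_false]⟩

theorem EllSpace.dist_ofFinset_rpow (s : Finset ℕ) (x y : ∀ n, Y n) :
    dist (ofFinset (q := q) ystar s x) (ofFinset ystar s y) ^ q = ellSum q s x y := by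
  have hq0 : q ≠ 0 := (zero_lt_one.trans_le hq.out).ne'
  have hdist : dist (ofFinset (q := q) ystar s x) (ofFinset ystar s y) =
      (∑' n, dist ((ofFinset (q := q) ystar s x).1 n) ((ofFinset (q := q) ystar s y).1 n) ^ q) ^
        (1 / q) := rfl
  rw [hdist, ← Real.rpow_mul (tsum_nonneg fun n => by positivity), one_div_mul_cancel hq0,
    Real.rpow_one, tsum_eq_sum (s := s)]
  · exact Finset.sum_congr rfl fun n hn => by simp [ofFinset, updateFinset, hn]
  · intro n hn
    simp [ofFinset, updateFinset, hn, Real.zero_rpow hq0]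

theorem ellRel_iff_ellRel_ofFinset_Ico {l : ℕ → ℕ} (hl : StrictMono l) (x y : ∀ n, Y n) :
    EllRel Y q x y ↔ EllRel (fun _ => EllSpace Y q ystar) q
      (fun j => .ofFinset ystar (Finset.Ico (l j) (l (j + 1))) x)
      (fun j => .ofFinset ystar (Finset.Ico (l j) (l (j + 1))) y) := by
  simp only [EllRel, EllSpace.dist_ofFinset_rpow]
  exact summable_iff_summable_sum_Ico (fun n => by positivity) hl

end EllSum

section Localization

variable {A : ℕ → Type*} {Y : ℕ → Type*} [∀ n, PseudoMetricSpace (Y n)] {q : ℝ}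
  {θ : (∀ n, A n) → ∀ n, Y n} {z w : ∀ n, A n}

/-- The points `x` such that the images under `θ` of any two modifications of `x` below `k` are
close on the coordinates from `l` on. -/
def tailCloseSet (q : ℝ) (θ : (∀ n, A n) → ∀ n, Y n) (k l : ℕ) : Set (∀ n, A n) :=
  {x | ∀ (r r' : ∀ i : Finset.range k, A i) (N : ℕ),
    ellSum q (Finset.Ico l N) (θ (updateFinset x (Finset.range k) r))
      (θ (updateFinset x (Finset.range k) r')) ≤ (1 / 2) ^ k}

/-- The points `x` such that, on the coordinates below `l`, the image of `x` under `θ` is close to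
the image of the point that agrees with `x` below `k` and with `z` from `k` on. -/
def headCloseSet (q : ℝ) (θ : (∀ n, A n) → ∀ n, Y n) (z : ∀ n, A n) (k l : ℕ) :
    Set (∀ n, A n) :=
  {x | ellSum q (Finset.range l) (θ x)
    (θ (updateFinset z (Finset.range k) ((Finset.range k).restrict x))) ≤ (1 / 2) ^ k}

theorem eventually_mem_tailCloseSet [∀ n, Finite (A n)]
    (htail : ∀ x y, (∀ᶠ n in cofinite, x n = y n) → EllRel Y q (θ x) (θ y)) (k : ℕ)
    (x : ∀ n, A n) : ∀ᶠ l in atTop, x ∈ tailCloseSet q θ k l := by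
  refine eventually_all.2 fun r => eventually_all.2 fun r' => ?_
  refine eventually_forall_sum_Ico_le (fun n => by positivity) (htail _ _ ?_) (by positivity)
  filter_upwards [(Finset.range k).eventually_cofinite_notMem] with n hn
  simp only [updateFinset, hn, dite_false]

theorem updateFinset_range_update {k c : ℕ} (hkc : k ≤ c)
    (hw : ∀ n ∈ Set.Ico k c, w n = z n) :
    updateFinset (update z c (w c)) (Finset.range k) ((Finset.range k).restrict w) =
      updateFinset z (Finset.range (c + 1)) ((Finset.range (c + 1)).restrict w) := by
  funext n
  by_cases hnk : n < k
  · simp [updateFinset, hnk, show n < c + 1 by omega]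
  rcases lt_trichotomy n c with hnc | rfl | hnc
  · simp [updateFinset, hnk, hnc.ne, show n < c + 1 by omega, hw n ⟨not_lt.1 hnk, hnc⟩]
  · simp [updateFinset, hnk]
  · simp [updateFinset, hnk, hnc.ne', show ¬ n < c + 1 by omega]

theorem ellSum_Ico_update_le (hq : 0 ≤ q) {k c l l' : ℕ} (hkc : k ≤ c)
    (hw : ∀ n ∈ Set.Ico k c, w n = z n)
    (hw_head : w ∈ headCloseSet q θ z (c + 1) l')
    (hw_tail : update z c (w c) ∈ tailCloseSet q θ k l) :
    ellSum q (Finset.Ico l l') (θ w) (θ (update z c (w c))) ≤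
      2 ^ q * ((1 / 2) ^ (c + 1) + (1 / 2) ^ k) := by
  set v := update z c (w c)
  have htail := hw_tail ((Finset.range k).restrict w) ((Finset.range k).restrict v) l'
  rw [updateFinset_restrict, updateFinset_range_update hkc hw] at htail
  have hhead := (ellSum_mono (q := q) (s := Finset.Ico l l') (t := Finset.range l')
    (fun n hn => Finset.mem_range.2 (Finset.mem_Ico.1 hn).2) _ _).trans hw_head
  exact (ellSum_triangle hq _ _ _ _).trans (by gcongr)

variable [∀ n, Finite (A n)] [∀ n, TopologicalSpace (A n)]

theorem measurableSet_tailCloseSet [MeasurableSpace (∀ n, A n)] [BorelSpace (∀ n, A n)]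
    [∀ n, MeasurableSpace (Y n)] [∀ n, BorelSpace (Y n)] [∀ n, SecondCountableTopology (Y n)]
    (hθ : ∀ n, Measurable fun x => θ x n) (k l : ℕ) :
    MeasurableSet (tailCloseSet q θ k l) := by
  simp only [tailCloseSet, Set.ofPred_forall]
  refine .iInter fun r => .iInter fun r' => .iInter fun N => measurableSet_le ?_ measurable_const
  refine Finset.measurable_fun_sum _ fun n _ => Measurable.pow_const ?_ _
  exact ((hθ n).comp (continuous_updateFinset_left _ r).measurable).dist
    ((hθ n).comp (continuous_updateFinset_left _ r').measurable)

variable [∀ n, DiscreteTopology (A n)]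

theorem eventually_forall_mem_headCloseSet (hq : 0 < q) {R : Set (∀ n, A n)}
    (hcont : ∀ n, ContinuousOn (fun x => θ x n) R)
    (hz : ∀ (s : Finset ℕ) r, updateFinset z s r ∈ R) (k l : ℕ) :
    ∀ᶠ M in atTop, ∀ w ∈ R, (∀ n ∈ Set.Ico k M, w n = z n) → w ∈ headCloseSet q θ z k l := by
  have hnhds : ∀ r, ∀ᶠ w in 𝓝 (updateFinset z (Finset.range k) r), w ∈ R →
      ellSum q (Finset.range l) (θ w) (θ (updateFinset z (Finset.range k) r)) ≤ (1 / 2) ^ k := by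
    refine fun r => eventually_nhdsWithin_iff.1 ?_
    have hsum : ContinuousOn (fun w => ellSum q (Finset.range l) (θ w)
        (θ (updateFinset z (Finset.range k) r))) R :=
      continuousOn_finsetSum _ fun n _ =>
        (continuous_dist.comp_continuousOn
          (ContinuousOn.prodMk (hcont n) continuousOn_const)).rpow_const fun _ _ => Or.inr hq.le
    refine (hsum _ (hz _ r)).eventually_le_const ?_
    simp [ellSum, Real.zero_rpow hq.ne']
  filter_upwards [eventually_forall_of_eventually_nhds_updateFinset hnhds] with M hM w hwR hw
  exact hM w hw hwR

theorem eventually_forall_mem_tailCloseSet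
    (htail : ∀ x y, (∀ᶠ n in cofinite, x n = y n) → EllRel Y q (θ x) (θ y))
    {R : Set (∀ n, A n)}
    (hopen : ∀ k l, ∀ x ∈ R, x ∈ tailCloseSet q θ k l → ∀ᶠ w in 𝓝[R] x, w ∈ tailCloseSet q θ k l)
    (hz : ∀ (s : Finset ℕ) r, updateFinset z s r ∈ R) (k : ℕ) :
    ∀ᶠ l in atTop, ∀ᶠ M in atTop, ∀ w ∈ R, (∀ n ∈ Set.Ico k M, w n = z n) →
      w ∈ tailCloseSet q θ k l := by
  filter_upwards [eventually_all.2 fun r =>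
    eventually_mem_tailCloseSet htail k (updateFinset z (Finset.range k) r)] with l hl
  filter_upwards [eventually_forall_of_eventually_nhds_updateFinset fun r =>
    eventually_nhdsWithin_iff.1 (hopen k l _ (hz _ r) (hl r))] with M hM w hwR hw
  exact hM w hw hwR

variable [MeasurableSpace (∀ n, A n)] [BorelSpace (∀ n, A n)] [∀ n, MeasurableSpace (Y n)]
  [∀ n, BorelSpace (Y n)] [∀ n, SecondCountableTopology (Y n)]

theorem exists_isGδ_continuousOn_tailCloseSet (hθ : ∀ n, Measurable fun x => θ x n) :
    ∃ R : Set (∀ n, A n), IsGδ R ∧ R ∈ residual (∀ n, A n) ∧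
      (∀ n, ContinuousOn (fun x => θ x n) R) ∧
      ∀ k l, ∀ x ∈ R, x ∈ tailCloseSet q θ k l → ∀ᶠ w in 𝓝[R] x, w ∈ tailCloseSet q θ k l := by
  choose R₁ hR₁ hcont using fun n => exists_residual_continuousOn_of_measurable (hθ n)
  obtain ⟨R₂, hR₂, hopen⟩ := exists_residual_forall_eventually_mem
    (V := fun a : ℕ × ℕ => tailCloseSet q θ a.1 a.2)
    fun a => measurableSet_tailCloseSet hθ a.1 a.2
  obtain ⟨R, hR_sub, hR, hR_dense⟩ := mem_residual.1 (inter_mem (countable_iInter_mem.2 hR₁) hR₂)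
  refine ⟨R, hR, residual_of_dense_Gδ hR hR_dense, fun n => (hcont n).mono fun x hx =>
    Set.mem_iInter.1 (hR_sub hx).1 n, fun k l x hx hxV => ?_⟩
  exact (hopen (k, l) x (hR_sub hx).2 hxV).filter_mono <|
    nhdsWithin_mono _ fun x hx => (hR_sub hx).2

variable [∀ n, Nonempty (A n)]

theorem exists_summable_ellSum_update (hq : 0 < q) (hθ : ∀ n, Measurable fun x => θ x n)
    (htail : ∀ x y, (∀ᶠ n in cofinite, x n = y n) → EllRel Y q (θ x) (θ y)) :
    ∃ (z : ∀ n, A n) (c l : ℕ → ℕ), StrictMono c ∧ StrictMono l ∧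
      ∀ w, (∀ n ∉ Set.range c, w n = z n) → Summable fun j =>
        ellSum q (Finset.Ico (l j) (l (j + 1))) (θ w) (θ (update z (c j) (w (c j)))) := by
  obtain ⟨R, hR, hR_res, hcont, hopen⟩ := exists_isGδ_continuousOn_tailCloseSet (q := q) hθ
  obtain ⟨z, hz⟩ := exists_forall_updateFinset_mem_of_residual hR_res
  obtain ⟨k, c, l, hl, hkc, hQ⟩ := exists_sparse_coordinates hR hz
    (Q := fun k l => tailCloseSet q θ k l ∩ headCloseSet q θ z k l) fun k => by
      filter_upwards [eventually_forall_mem_tailCloseSet htail hopen hz k] with l hl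
      filter_upwards [hl, eventually_forall_mem_headCloseSet hq hcont hz k l] with M htail hhead
      exact fun w hwR hw => ⟨htail w hwR hw, hhead w hwR hw⟩
  have hk : StrictMono k := strictMono_nat_of_lt_succ fun j => by grind
  refine ⟨z, c, l, strictMono_nat_of_lt_succ fun j => by grind, hl, fun w hw => ?_⟩
  have hgeom := summable_two_mul_half_pow.mul_left (2 ^ q)
  refine hgeom.of_nonneg_of_le (fun j => ellSum_nonneg _ _ _) fun j => ?_
  have hv : ∀ n ∉ Set.range c, update z (c j) (w (c j)) n = z n := fun n hn =>
    update_of_ne (fun h => hn ⟨j, h.symm⟩) _ _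
  have hw_head := (hQ w hw (j + 1)).2.2
  rw [(hkc j).2] at hw_head
  calc ellSum q (Finset.Ico (l j) (l (j + 1))) (θ w) (θ (update z (c j) (w (c j))))
      ≤ 2 ^ q * ((1 / 2) ^ (c j + 1) + (1 / 2) ^ k j) :=
        ellSum_Ico_update_le hq.le (hkc j).1 (hQ w hw j).1 hw_head (hQ _ hv j).2.1
    _ ≤ 2 ^ q * ((1 / 2) ^ j + (1 / 2) ^ j) := by
        have hj : j ≤ k j := hk.le_apply
        have hpow : ∀ m, j ≤ m → (1 / 2 : ℝ) ^ m ≤ (1 / 2) ^ j := fun m hm =>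
          pow_le_pow_of_le_one (by norm_num) (by norm_num) hm
        exact mul_le_mul_of_nonneg_left
          (add_le_add (hpow _ (hj.trans ((hkc j).1.trans (Nat.le_succ _)))) (hpow _ hj))
          (by positivity)
    _ = 2 ^ q * (2 * (1 / 2) ^ j) := by ring

theorem exists_forall_ellRel_iff_of_measurable [hq : Fact (1 ≤ q)] (ystar : ∀ n, Y n)
    (hθ : ∀ n, Measurable fun x => θ x n)
    (htail : ∀ x y, (∀ᶠ n in cofinite, x n = y n) → EllRel Y q (θ x) (θ y)) :
    ∃ (z : ∀ n, A n) (c : ℕ → ℕ) (T : ∀ j, A (c j) → EllSpace Y q ystar), StrictMono c ∧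
      ∀ w w', (∀ n ∉ Set.range c, w n = z n ∧ w' n = z n) →
        (EllRel Y q (θ w) (θ w') ↔ EllRel (fun _ => EllSpace Y q ystar) q
          (fun j => T j (w (c j))) (fun j => T j (w' (c j)))) := by
  obtain ⟨z, c, l, hc, hl, hsum⟩ :=
    exists_summable_ellSum_update (zero_lt_one.trans_le hq.out) hθ htail
  have hblock : ∀ w, (∀ n ∉ Set.range c, w n = z n) → EllRel (fun _ => EllSpace Y q ystar) q
      (fun j => .ofFinset ystar (Finset.Ico (l j) (l (j + 1))) (θ w))
      (fun j => .ofFinset ystar (Finset.Ico (l j) (l (j + 1)))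
        (θ (update z (c j) (w (c j))))) := fun w hw => by
    simpa only [EllRel, EllSpace.dist_ofFinset_rpow] using hsum w hw
  refine ⟨z, c, fun j a => .ofFinset ystar (Finset.Ico (l j) (l (j + 1)))
    (θ (update z (c j) a)), hc, fun w w' hw => ?_⟩
  exact (ellRel_iff_ellRel_ofFinset_Ico ystar hl _ _).trans <|
    (hblock w fun n hn => (hw n hn).1).congr hq.out (hblock w' fun n hn => (hw n hn).2)

end Localization

section Reduction

theorem exists_forall_eq_of_injective {κ ι : Type*} {A : ι → Type*} {g : κ → ι} (hg : Injective g)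
    (z : ∀ i, A i) (a : ∀ k, A (g k)) :
    ∃ w : ∀ i, A i, (∀ k, w (g k) = a k) ∧ ∀ i ∉ Set.range g, w i = z i := by
  have h : ∀ i, ∃ b : A i, (∀ k (hk : g k = i), b = hk ▸ a k) ∧ (i ∉ Set.range g → b = z i) := by
    intro i
    by_cases hi : i ∈ Set.range g
    · obtain ⟨k, rfl⟩ := hi
      exact ⟨a k, fun k' hk' => by cases hg hk'; rfl, fun hk => absurd ⟨k, rfl⟩ hk⟩
    · exact ⟨z i, fun k hk => absurd ⟨k, hk⟩ hi, fun _ => rfl⟩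
  choose w hw_a hw_z using h
  exact ⟨w, fun k => hw_a _ k rfl, hw_z⟩

theorem ellRel_iff_summable_comp {A : ℕ → Type*} [∀ n, PseudoMetricSpace (A n)] {p : ℝ}
    (hp : p ≠ 0) {g : ℕ → ℕ} (hg : Injective g) {x y : ∀ n, A n}
    (hxy : ∀ n ∉ Set.range g, x n = y n) :
    EllRel A p x y ↔ Summable fun k => dist (x (g k)) (y (g k)) ^ p :=
  (hg.summable_iff fun n hn => by rw [hxy n hn, dist_self, Real.zero_rpow hp]).symm

variable {X : Type*} [MetricSpace X] {Y : ℕ → Type*} [∀ n, PseudoMetricSpace (Y n)] {p q : ℝ}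
  {F : ℕ → Finset X}

theorem subsequentiallyReduces_extend {E : Type*} [PseudoMetricSpace E] (hp : p ≠ 0) (hq : q ≠ 0)
    {θ : (∀ n, {u // u ∈ F n}) → ∀ n, Y n} (hθ : ∀ x y, FRel F p x y ↔ EllRel Y q (θ x) (θ y))
    {z : ∀ n, {u // u ∈ F n}} {c : ℕ → ℕ} (hc : Injective c) {T : ∀ j, {u // u ∈ F (c j)} → E}
    (hT : ∀ w w', (∀ n ∉ Set.range c, w n = z n ∧ w' n = z n) →
      (EllRel Y q (θ w) (θ w') ↔
        EllRel (fun _ => E) q (fun j => T j (w (c j))) (fun j => T j (w' (c j)))))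
    (T₀ : ℕ → X → E) :
    SubsequentiallyReduces (fun j => (F (c j) : Set X)) (fun j => extend (↑) (T j) (T₀ j)) p q := by
  intro f hf u v huv
  have hcf : Injective (c ∘ f) := hc.comp hf.injective
  obtain ⟨w, hw, hwz⟩ := exists_forall_eq_of_injective hcf z fun k => ⟨u k, (huv k).1⟩
  obtain ⟨w', hw', hwz'⟩ := exists_forall_eq_of_injective hcf z fun k => ⟨v k, (huv k).2⟩
  have hsub : ∀ n ∉ Set.range c, w n = z n ∧ w' n = z n := fun n hn =>
    have hn' := fun h => hn (Set.range_comp_subset_range f c h)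
    ⟨hwz n hn', hwz' n hn'⟩
  have hoff : ∀ j ∉ Set.range f, w (c j) = w' (c j) := fun j hj =>
    have hj' : c j ∉ Set.range (c ∘ f) := by rwa [Set.range_comp, hc.mem_set_image]
    (hwz _ hj').trans (hwz' _ hj').symm
  have hextend : ∀ j (a : {u // u ∈ F (c j)}), extend (↑) (T j) (T₀ j) (a : X) = T j a :=
    fun j => Subtype.val_injective.extend_apply _ _
  simp only [comp_apply] at hw hw'
  calc (Summable fun k => dist (u k) (v k) ^ p) ↔ FRel F p w w' := by
        rw [FRel, ellRel_iff_summable_comp hp hcf fun n hn => (hwz n hn).trans (hwz' n hn).symm]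
        simp only [comp_apply, hw, hw', Subtype.dist_eq]
    _ ↔ EllRel Y q (θ w) (θ w') := hθ w w'
    _ ↔ EllRel (fun _ => E) q (fun j => T j (w (c j))) (fun j => T j (w' (c j))) := hT w w' hsub
    _ ↔ Summable fun k => dist (extend (↑) (T (f k)) (T₀ (f k)) (u k))
          (extend (↑) (T (f k)) (T₀ (f k)) (v k)) ^ q := by
        rw [ellRel_iff_summable_comp hq hf.injective fun j hj => by rw [hoff j hj]]
        simp only [hw, hw', ← hextend]

theorem BorelReducible.exists_subsequentiallyReduces
    [∀ n, TopologicalSpace.SeparableSpace (Y n)] (hp : p ≠ 0) [hq : Fact (1 ≤ q)]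
    (hF : ∀ n, (F n).Nonempty) (hred : BorelReducible (FRel F p) (EllRel Y q)) (ystar : ∀ n, Y n) :
    ∃ (c : ℕ → ℕ) (T : ℕ → X → EllSpace Y q ystar), StrictMono c ∧
      SubsequentiallyReduces (fun j => (F (c j) : Set X)) T p q := by
  obtain ⟨θ, hθ_meas, hθ⟩ := hred
  have : ∀ n, Nonempty {u // u ∈ F n} := fun n => (hF n).to_subtype
  have : ∀ n, SecondCountableTopology (Y n) := fun n =>
    UniformSpace.secondCountable_of_separable _
  let _ : MeasurableSpace (∀ n, {u // u ∈ F n}) := borel _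
  have : BorelSpace (∀ n, {u // u ∈ F n}) := ⟨rfl⟩
  let _ : ∀ n, MeasurableSpace (Y n) := fun n => borel _
  have : ∀ n, BorelSpace (Y n) := fun n => ⟨rfl⟩
  have hθ_apply : ∀ n, Measurable fun x => θ x n := fun n =>
    (continuous_apply n).borel_measurable.comp hθ_meas
  obtain ⟨z, c, T, hc, hT⟩ := exists_forall_ellRel_iff_of_measurable ystar hθ_apply
    fun x y hxy => (hθ x y).1 (EllRel.of_eventually_eq hp hxy)
  exact ⟨c, _, hc, subsequentiallyReduces_extend hp (zero_lt_one.trans_le hq.out).ne' hθ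
    hc.injective hT fun j _ => T j (z (c j))⟩

end Reduction

theorem mainTheorem4_general {X : Type*} [MetricSpace X] {Y : ℕ → Type*}
    [∀ n, PseudoMetricSpace (Y n)] [∀ n, TopologicalSpace.SeparableSpace (Y n)]
    {p q : ℝ} (hp : 0 < p) [hq : Fact (1 ≤ q)] {C : ℝ} (hC : 0 < C) (hlink : Link X C)
    {F : ℕ → Finset X} (hF : IsFiniteExhaustion F)
    (hred : BorelReducible (FRel F p) (EllRel Y q)) (ystar : ∀ n, Y n) :
    FinitelyHolderEmbeds X (EllSpace Y q ystar) C (p / q) := by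
  obtain ⟨c, T, hc, hT⟩ := hred.exists_subsequentiallyReduces hp.ne' hF.nonempty ystar
  have hmem : ∀ u ∈ ⋃ n, (F n : Set X), ∀ᶠ j in atTop, u ∈ (F (c j) : Set X) := fun u hu => by
    obtain ⟨n, hn⟩ := Set.mem_iUnion.1 hu
    filter_upwards [eventually_ge_atTop n] with j hj
    exact hF.mono (hj.trans hc.le_apply) hn
  exact hT.finitelyHolderEmbeds hF.dense hmem hp (zero_lt_one.trans_le hq.out) hC hlink

theorem mainTheorem4 {X : Type*} [MetricSpace X] [CompleteSpace X]
    [TopologicalSpace.SeparableSpace X]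
    {Y : ℕ → Type*} [∀ n, MetricSpace (Y n)] [∀ n, CompleteSpace (Y n)]
    [∀ n, TopologicalSpace.SeparableSpace (Y n)]
    (p q : ℝ) (hp : 1 ≤ p) [Fact (1 ≤ q)] (C : ℝ) (hC : 0 < C) (hlink : Link X C)
    (F : ℕ → Finset X) (hF : IsFiniteExhaustion F)
    (hred : BorelReducible (FRel F p) (EllRel Y q)) (ystar : ∀ n, Y n) :
    FinitelyHolderEmbeds X (EllSpace Y q ystar) C (p / q) :=
  mainTheorem4_general (zero_lt_one.trans_le hp) hC hlink hF hred ystar
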